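/- Let $n$ be a natural number, and let $\mathbf j$ be the antiholomorphic involution of $\mathbb P_{\mathbb C}(\mathbb H^n)\cong\mathbb P^{2n-1}_{\mathbb C}$ induced by left multiplication by the quaternion $j$ on $\mathbb H^n=\mathbb C^n\oplus\mathbb C^n j$, that is, by the antilinear map $(z,w)\mapsto(-\bar w,\bar z)$. Let $X\subset\mathbb P_{\mathbb C}(\mathbb H^n)$ be a nonempty, possibly reducible, algebraic subvariety (the common zero set of a family of homogeneous polynomials) with $\mathbf j(X)=X$. If the complex codimension $(2n-1)-\dim X$ of $X$ is odd, then the degree of $X$ is even. Here $\dim X$ is the Krull dimension of the homogeneous coordinate ring of $X$ minus $1$, and the degree of $X$ is $r!$ times the leading coefficient of the Hilbert polynomial of $X$, where $r$ is the degree of that polynomial. -/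

import Mathlib

open scoped LinearAlgebra.Projectivization Quaternion Nat

namespace QuaternionicVariety

/-- The complex vector space underlying `ℍⁿ = ℂⁿ ⊕ ℂⁿ·j`, in the coordinates `q_k = z_k + w_k j`:
`v (Sum.inl k) = z_k` and `v (Sum.inr k) = w_k`. -/
abbrev HSpace (n : ℕ) : Type := Fin n ⊕ Fin n → ℂ

/-- The quaternion `j`. -/
def quatJ : ℍ := ⟨0, 0, 1, 0⟩

@[simp] theorem re_quatJ : quatJ.re = 0 := rfl
@[simp] theorem imI_quatJ : quatJ.imI = 0 := rfl
@[simp] theorem imJ_quatJ : quatJ.imJ = 1 := rfl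
@[simp] theorem imK_quatJ : quatJ.imK = 0 := rfl

/-- The vector of quaternions `q_k = z_k + w_k j` with the given complex coordinates. -/
noncomputable def toQuaternion {n : ℕ} (v : HSpace n) (k : Fin n) : ℍ :=
  (v (Sum.inl k) : ℍ) + (v (Sum.inr k) : ℍ) * quatJ

/-- The standard quaternionic structure: left multiplication by the quaternion `j`, that is
`(z, w) ↦ (-conj w, conj z)`. It is `ℂ`-antilinear. -/
noncomputable def jLin (n : ℕ) : HSpace n →ₛₗ[starRingEnd ℂ] HSpace n where
  toFun v := Sum.elim (fun k => -(starRingEnd ℂ) (v (Sum.inr k)))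
    (fun k => (starRingEnd ℂ) (v (Sum.inl k)))
  map_add' u v := by
    ext (k | k)
    · simp [add_comm]
    · simp
  map_smul' c v := by
    ext (k | k) <;> simp

/-- The coordinates identify `HSpace n` with `ℍⁿ`. -/
theorem toQuaternion_bijective (n : ℕ) :
    Function.Bijective (toQuaternion : HSpace n → Fin n → ℍ) := by
  constructor
  · intro u v h
    have h' := fun k => Quaternion.ext_iff.1 (congrFun h k)
    simp [toQuaternion] at h'
    ext (k | k)
    · exact Complex.ext (h' k).1 (h' k).2.1
    · exact Complex.ext (h' k).2.2.1 (h' k).2.2.2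
  · intro q
    refine ⟨Sum.elim (fun k => ⟨(q k).re, (q k).imI⟩) (fun k => ⟨(q k).imJ, (q k).imK⟩), ?_⟩
    ext k <;> simp [toQuaternion]

/-- Complex scalars act on `ℍⁿ` by left multiplication. -/
theorem toQuaternion_smul {n : ℕ} (c : ℂ) (v : HSpace n) (k : Fin n) :
    toQuaternion (c • v) k = (c : ℍ) * toQuaternion v k := by
  simp [toQuaternion, mul_add, mul_assoc]

/-- `jLin n` is left multiplication by the quaternion `j`. -/
theorem toQuaternion_jLin {n : ℕ} (v : HSpace n) (k : Fin n) :
    toQuaternion (jLin n v) k = quatJ * toQuaternion v k := by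
  ext <;> simp [toQuaternion, jLin]

theorem jLin_jLin {n : ℕ} (v : HSpace n) : jLin n (jLin n v) = -v := by
  ext (k | k) <;> simp [jLin]

theorem jLin_injective (n : ℕ) : Function.Injective (jLin n) := fun u v h => by
  have := congrArg (jLin n) h
  simpa [jLin_jLin] using this

/-- The quaternionic involution of `ℙ_ℂ(ℍⁿ)` induced by `j`. -/
noncomputable def jProj (n : ℕ) : ℙ ℂ (HSpace n) → ℙ ℂ (HSpace n) :=
  Projectivization.map (jLin n) (jLin_injective n)

/-- An algebraic subvariety of `ℙ_ℂ(ℍⁿ)`: the common zero set of a set of homogeneous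
polynomials (possibly reducible). -/
def IsAlgebraicSubvariety {n : ℕ} (X : Set (ℙ ℂ (HSpace n))) : Prop :=
  ∃ T : Set (MvPolynomial (Fin n ⊕ Fin n) ℂ),
    (∀ f ∈ T, ∃ d : ℕ, f.IsHomogeneous d) ∧
    ∀ (v : HSpace n) (hv : v ≠ 0),
      Projectivization.mk ℂ v hv ∈ X ↔ ∀ f ∈ T, MvPolynomial.eval v f = 0

/-- A quaternionic projective variety: an algebraic subvariety of `ℙ_ℂ(ℍⁿ)` invariant under the
quaternionic involution. -/
structure IsQuaternionicVariety {n : ℕ} (X : Set (ℙ ℂ (HSpace n))) : Prop where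
  algebraic : IsAlgebraicSubvariety X
  invariant : jProj n '' X = X

/-- The (punctured) affine cone over `X`. -/
def cone {n : ℕ} (X : Set (ℙ ℂ (HSpace n))) : Set (HSpace n) :=
  {v | ∃ hv : v ≠ 0, Projectivization.mk ℂ v hv ∈ X}

/-- The ideal of all polynomials vanishing on (the cone over) `X`. -/
noncomputable def idealOf {n : ℕ} (X : Set (ℙ ℂ (HSpace n))) :
    Ideal (MvPolynomial (Fin n ⊕ Fin n) ℂ) :=
  MvPolynomial.vanishingIdeal ℂ (cone X)

/-- The homogeneous coordinate ring of `X`. -/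
abbrev CoordRing {n : ℕ} (X : Set (ℙ ℂ (HSpace n))) : Type :=
  MvPolynomial (Fin n ⊕ Fin n) ℂ ⧸ idealOf X

/-- `X` has complex dimension `r`: its affine cone, that is its homogeneous coordinate ring, has
Krull dimension `r + 1`. (This never holds for empty `X`.) -/
def HasDim {n : ℕ} (X : Set (ℙ ℂ (HSpace n))) (r : ℕ) : Prop :=
  ringKrullDim (CoordRing X) = ((r + 1 : ℕ) : WithBot ℕ∞)

/-- `X` has complex codimension `c` in `ℙ_ℂ(ℍⁿ)`, a space of dimension `2n - 1`. -/
def HasCodim {n : ℕ} (X : Set (ℙ ℂ (HSpace n))) (c : ℕ) : Prop :=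
  ∃ r : ℕ, HasDim X r ∧ r + c + 1 = 2 * n

/-- The degree `m` part of the homogeneous coordinate ring: the classes of the forms of
degree `m`. -/
noncomputable def gradedPiece {n : ℕ} (X : Set (ℙ ℂ (HSpace n))) (m : ℕ) :
    Submodule ℂ (CoordRing X) :=
  (MvPolynomial.homogeneousSubmodule (Fin n ⊕ Fin n) ℂ m).map
    (Ideal.Quotient.mkₐ ℂ (idealOf X)).toLinearMap

/-- The Hilbert function of `X`. -/
noncomputable def hilbertFunction {n : ℕ} (X : Set (ℙ ℂ (HSpace n))) (m : ℕ) : ℕ :=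
  Module.finrank ℂ (gradedPiece X m)

/-- `P` is the Hilbert polynomial of `X`. -/
def IsHilbertPolynomial {n : ℕ} (X : Set (ℙ ℂ (HSpace n))) (P : Polynomial ℚ) : Prop :=
  ∀ᶠ m : ℕ in Filter.atTop, (hilbertFunction X m : ℚ) = P.eval (m : ℚ)

/-- `X` has degree `d`: it has a Hilbert polynomial, and the leading coefficient of that
polynomial is `d / r!`, where `r` is its degree. -/
def HasDegree {n : ℕ} (X : Set (ℙ ℂ (HSpace n))) (d : ℕ) : Prop :=
  ∃ P : Polynomial ℚ, IsHilbertPolynomial X P ∧ (d : ℚ) = (P.natDegree)! * P.leadingCoeff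

/-- A variety has at most one Hilbert polynomial. -/
theorem IsHilbertPolynomial.unique {n : ℕ} {X : Set (ℙ ℂ (HSpace n))} {P Q : Polynomial ℚ}
    (hP : IsHilbertPolynomial X P) (hQ : IsHilbertPolynomial X Q) : P = Q := by
  obtain ⟨N, hN⟩ := Filter.eventually_atTop.1 (hP.and hQ)
  refine Polynomial.eq_of_infinite_eval_eq P Q
    (Set.Infinite.mono ?_ ((Set.Ici_infinite N).image (Nat.cast_injective (R := ℚ)).injOn))
  rintro _ ⟨m, hm, rfl⟩
  exact (hN m hm).1.symm.trans (hN m hm).2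

/-- The degree is unique. -/
theorem HasDegree.unique {n : ℕ} {X : Set (ℙ ℂ (HSpace n))} {d e : ℕ}
    (hd : HasDegree X d) (he : HasDegree X e) : d = e := by
  obtain ⟨P, hP, h1⟩ := hd
  obtain ⟨Q, hQ, h2⟩ := he
  obtain rfl := hP.unique hQ
  exact_mod_cast h1.trans h2.symm

end QuaternionicVariety

/-! On `ℍⁿ` the map `j` is antilinear with square `-1`, so `f ↦ conj (f (j ·))` acts antilinearly on
forms of degree `m` with square `(-1) ^ m`. It preserves the ideal of a `j`-invariant `X`. For odd
`m` the degree `m` part of the coordinate ring therefore carries a quaternionic structure, and its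
dimension is even (`even_hilbertFunction`).

The Hilbert polynomial `P` has degree `r = dim X` (`exists_hilbertPolynomial`), which is even when
the codimension is odd. The degree of `X` is the `r`-th forward difference of `P`, namely `∑ (-1) ^
(r - l) * r.choose l * P (x + l)`. For a large odd `x`, the terms with even `l` contain an even
value of the Hilbert function. The terms with odd `l` contain an even binomial coefficient, because
`r` is even (`exists_even_eq_factorial_mul_leadingCoeff`).

The existence of `P` is Hilbert–Serre. Its degree comes from Noether normalization: the coordinate
ring is finite over a polynomial ring in `r + 1` variables, and the two rings have the same order of
growth. -/

namespace QuaternionicVariety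

open MvPolynomial

/-! ### Linear algebra and finite differences of polynomials. -/

section FiniteDimensional

variable {k V W : Type*} [Field k] [AddCommGroup V] [Module k V] [AddCommGroup W] [Module k W]

theorem finrank_map_add_finrank_inf_ker (f : V →ₗ[k] W) (p : Submodule k V)
    [FiniteDimensional k p] :
    Module.finrank k (p.map f) + Module.finrank k (p ⊓ f.ker : Submodule k V) =
      Module.finrank k p := by
  have h := LinearMap.finrank_range_add_finrank_ker (f.domRestrict p)
  rw [LinearMap.range_domRestrict, LinearMap.ker_domRestrict] at h
  rw [← h, ← Submodule.finrank_map_subtype_eq, Submodule.map_comap_subtype]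

theorem finrank_map_of_injective (f : V →ₗ[k] W) (hf : Function.Injective f)
    (p : Submodule k V) : Module.finrank k (p.map f) = Module.finrank k p :=
  (Submodule.equivMapOfInjective f hf p).finrank_eq.symm

end FiniteDimensional

/-- For every polynomial `P` there is a polynomial with forward difference `P`. -/
theorem exists_fwdDiff_eq (P : Polynomial ℚ) :
    ∃ Q : Polynomial ℚ, ∀ x : ℚ, Q.eval (x + 1) - Q.eval x = P.eval x := by
  induction P using Polynomial.induction_on' with
  | add P₁ P₂ h₁ h₂ =>
    obtain ⟨Q₁, h₁⟩ := h₁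
    obtain ⟨Q₂, h₂⟩ := h₂
    refine ⟨Q₁ + Q₂, fun x => ?_⟩
    simp only [Polynomial.eval_add, ← h₁, ← h₂]
    ring
  | monomial d a =>
    -- Bernoulli polynomials satisfy `B_{d+1}(x + 1) - B_{d+1}(x) = (d + 1) x ^ d`.
    refine ⟨Polynomial.C (a / (d + 1)) * Polynomial.bernoulli (d + 1), fun x => ?_⟩
    have hd : (d + 1 : ℚ) ≠ 0 := by positivity
    rw [add_comm x 1, Polynomial.eval_C_mul, Polynomial.eval_C_mul,
      Polynomial.bernoulli_eval_one_add, Polynomial.eval_monomial]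
    simp only [Nat.add_sub_cancel, Nat.cast_add, Nat.cast_one]
    field_simp
    ring

/-- A function on `ℕ` that agrees with a polynomial at all large arguments. -/
def EventuallyPolynomial (f : ℕ → ℚ) : Prop :=
  ∃ P : Polynomial ℚ, ∀ᶠ m : ℕ in Filter.atTop, f m = P.eval (m : ℚ)

theorem eventuallyPolynomial_of_succ {f : ℕ → ℚ}
    (h : EventuallyPolynomial fun m => f (m + 1)) : EventuallyPolynomial f := by
  obtain ⟨P, hP⟩ := h
  refine ⟨P.comp (Polynomial.X - Polynomial.C 1), ?_⟩
  obtain ⟨N, hN⟩ := Filter.eventually_atTop.1 hP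
  refine Filter.eventually_atTop.2 ⟨N + 1, fun m hm => ?_⟩
  obtain ⟨m, rfl⟩ : ∃ l, m = l + 1 := ⟨m - 1, by omega⟩
  simp [hN m (by omega)]

theorem EventuallyPolynomial.comp_succ {f : ℕ → ℚ} (h : EventuallyPolynomial f) :
    EventuallyPolynomial fun m => f (m + 1) := by
  obtain ⟨P, hP⟩ := h
  refine ⟨P.comp (Polynomial.X + Polynomial.C 1), ?_⟩
  filter_upwards [(Filter.tendsto_add_atTop_nat 1).eventually hP] with m hm
  simp [hm]

theorem EventuallyPolynomial.add {f g : ℕ → ℚ} (hf : EventuallyPolynomial f)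
    (hg : EventuallyPolynomial g) : EventuallyPolynomial fun m => f m + g m := by
  obtain ⟨P, hP⟩ := hf
  obtain ⟨Q, hQ⟩ := hg
  refine ⟨P + Q, ?_⟩
  filter_upwards [hP, hQ] with m h₁ h₂
  simp [h₁, h₂]

theorem exists_polynomial_of_sub_eq {f : ℕ → ℚ} {P : Polynomial ℚ}
    (h : ∀ᶠ m : ℕ in Filter.atTop, f (m + 1) - f m = P.eval (m : ℚ)) :
    ∃ Q : Polynomial ℚ, (∀ᶠ m : ℕ in Filter.atTop, f m = Q.eval (m : ℚ)) ∧
      ∀ x, Q.eval (x + 1) - Q.eval x = P.eval x := by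
  obtain ⟨Q, hQ⟩ := exists_fwdDiff_eq P
  obtain ⟨N, hN⟩ := Filter.eventually_atTop.1 h
  -- The constant matches the values at `N`; equal differences propagate the agreement upwards.
  refine ⟨Q + Polynomial.C (f N - Q.eval (N : ℚ)),
    Filter.eventually_atTop.2 ⟨N, fun m hm => ?_⟩, fun x => ?_⟩
  · induction m, hm using Nat.le_induction with
    | base => simp
    | succ m hm ih =>
      have h₁ := hN m hm
      have h₂ := hQ m
      simp only [Polynomial.eval_add, Polynomial.eval_C, Nat.cast_add, Nat.cast_one] at ih ⊢
      linarith
  · rw [← hQ]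
    simp

/-! ### Hilbert functions of homogeneous ideals and Hilbert–Serre. -/

section HilbertFunction

variable {σ k : Type*} [Field k]

/-- An ideal that contains the homogeneous components of its members. -/
def IsHomogeneousIdeal (I : Ideal (MvPolynomial σ k)) : Prop :=
  ∀ f ∈ I, ∀ m, homogeneousComponent m f ∈ I

theorem homogeneousComponent_X_mul_succ (i : σ) (f : MvPolynomial σ k) (m : ℕ) :
    homogeneousComponent (m + 1) (X i * f) = X i * homogeneousComponent m f := by
  classical
  ext d
  rw [coeff_homogeneousComponent, coeff_X_mul', coeff_X_mul', coeff_homogeneousComponent]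
  by_cases hi : i ∈ d.support
  · have hd : (d - Finsupp.single i 1).degree + 1 = d.degree := by
      have h : Finsupp.single i 1 ≤ d := by
        rw [Finsupp.single_le_iff]
        exact Nat.one_le_iff_ne_zero.2 (Finsupp.mem_support_iff.1 hi)
      conv_rhs => rw [← tsub_add_cancel_of_le h]
      simp
    simp [hi, ← hd]
  · simp [hi]

theorem homogeneousComponent_X_mul_zero (i : σ) (f : MvPolynomial σ k) :
    homogeneousComponent 0 (X i * f) = 0 := by
  classical
  rw [homogeneousComponent_zero, coeff_X_mul']
  simp

/-- The Hilbert function of the quotient by `I`. -/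
noncomputable def idealHilbert (I : Ideal (MvPolynomial σ k)) (m : ℕ) : ℕ :=
  Module.finrank k ((homogeneousSubmodule σ k m).map (Ideal.Quotient.mkₐ k I).toLinearMap)

theorem ker_mkₐ_toLinearMap (I : Ideal (MvPolynomial σ k)) :
    (Ideal.Quotient.mkₐ k I).toLinearMap.ker = I.restrictScalars k := by
  ext f
  simp [Ideal.Quotient.eq_zero_iff_mem]

instance [Finite σ] (m : ℕ) : FiniteDimensional k (homogeneousSubmodule σ k m) :=
  Module.Finite.iff_fg.2 (homogeneousSubmodule_fg σ k m)

theorem idealHilbert_add_finrank [Finite σ] (I : Ideal (MvPolynomial σ k)) (m : ℕ) :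
    idealHilbert I m + Module.finrank k
      (homogeneousSubmodule σ k m ⊓ I.restrictScalars k : Submodule k (MvPolynomial σ k)) =
      Module.finrank k (homogeneousSubmodule σ k m) := by
  rw [idealHilbert, ← ker_mkₐ_toLinearMap, finrank_map_add_finrank_inf_ker]

variable {I : Ideal (MvPolynomial σ k)}

theorem IsHomogeneousIdeal.colon_X (hI : IsHomogeneousIdeal I) (i : σ) :
    IsHomogeneousIdeal (I.colon {(X i : MvPolynomial σ k)}) := by
  intro f hf m
  rw [Submodule.mem_colon_singleton, smul_eq_mul, mul_comm] at hf ⊢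
  rw [← homogeneousComponent_X_mul_succ]
  exact hI _ hf _

theorem IsHomogeneousIdeal.sup_span_X (hI : IsHomogeneousIdeal I) (i : σ) :
    IsHomogeneousIdeal (I ⊔ Ideal.span {(X i : MvPolynomial σ k)}) := by
  intro f hf m
  obtain ⟨g, hg, h, hh, rfl⟩ := Submodule.mem_sup.1 hf
  obtain ⟨q, rfl⟩ := Ideal.mem_span_singleton.1 hh
  rw [map_add]
  refine add_mem (Ideal.mem_sup_left (hI g hg m)) (Ideal.mem_sup_right ?_)
  cases m with
  | zero =>
    rw [homogeneousComponent_X_mul_zero]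
    exact zero_mem _
  | succ m =>
    rw [homogeneousComponent_X_mul_succ]
    exact Ideal.mul_mem_right _ _ (Ideal.mem_span_singleton_self _)

/-- This is the exact sequence `0 → S/(I : x)(-1) → S/I → S/(I + (x)) → 0` in degree `m + 1`. On the
side of the ideals, `I + (x)` is in that degree the sum of `I` and `x · S_m`, and these meet in `x ·
(I : x)_m`. -/
theorem idealHilbert_succ [Finite σ] (hI : IsHomogeneousIdeal I) (i : σ) (m : ℕ) :
    idealHilbert I (m + 1) = idealHilbert (I.colon {(X i : MvPolynomial σ k)}) m +
      idealHilbert (I ⊔ Ideal.span {(X i : MvPolynomial σ k)}) (m + 1) := by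
  set J := I.colon {(X i : MvPolynomial σ k)} with hJ
  set K := I ⊔ Ideal.span {(X i : MvPolynomial σ k)} with hK
  let μ : MvPolynomial σ k →ₗ[k] MvPolynomial σ k := LinearMap.mulLeft k (X i)
  have hμ : Function.Injective μ := mul_right_injective₀ (X_ne_zero i)
  have hsup : homogeneousSubmodule σ k (m + 1) ⊓ K.restrictScalars k =
      (homogeneousSubmodule σ k (m + 1) ⊓ I.restrictScalars k) ⊔
        (homogeneousSubmodule σ k m).map μ := by
    apply le_antisymm
    · rintro f ⟨hf, hfK⟩
      obtain ⟨g, hg, h, hh, rfl⟩ := Submodule.mem_sup.1 hfK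
      obtain ⟨q, rfl⟩ := Ideal.mem_span_singleton.1 hh
      rw [SetLike.mem_coe, mem_homogeneousSubmodule] at hf
      rw [← homogeneousComponent_eq_self hf, map_add, homogeneousComponent_X_mul_succ]
      refine Submodule.add_mem_sup ⟨homogeneousComponent_mem _ _, hI g hg _⟩ ?_
      exact ⟨_, homogeneousComponent_mem _ _, rfl⟩
    · refine sup_le (inf_le_inf_left _ fun f hf => Ideal.mem_sup_left hf) ?_
      rintro _ ⟨f, hf, rfl⟩
      refine ⟨?_, Ideal.mem_sup_right (Ideal.mul_mem_right _ _ (Ideal.mem_span_singleton_self _))⟩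
      have := (isHomogeneous_X k i).mul ((mem_homogeneousSubmodule _ _).1 hf)
      rwa [add_comm] at this
  have hinf : (homogeneousSubmodule σ k (m + 1) ⊓ I.restrictScalars k) ⊓
        (homogeneousSubmodule σ k m).map μ =
      (homogeneousSubmodule σ k m ⊓ J.restrictScalars k).map μ := by
    apply le_antisymm
    · rintro _ ⟨⟨-, hI'⟩, f, hf, rfl⟩
      refine ⟨f, ⟨hf, ?_⟩, rfl⟩
      change f ∈ J
      rw [hJ, Submodule.mem_colon_singleton, smul_eq_mul, mul_comm]
      exact hI'
    · rintro _ ⟨f, ⟨hf, hfJ⟩, rfl⟩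
      refine ⟨⟨?_, ?_⟩, f, hf, rfl⟩
      · have := (isHomogeneous_X k i).mul ((mem_homogeneousSubmodule _ _).1 hf)
        rwa [add_comm] at this
      · change f ∈ J at hfJ
        rw [hJ, Submodule.mem_colon_singleton, smul_eq_mul, mul_comm] at hfJ
        exact hfJ
  have h := Submodule.finrank_sup_add_finrank_inf_eq
    (homogeneousSubmodule σ k (m + 1) ⊓ I.restrictScalars k) ((homogeneousSubmodule σ k m).map μ)
  rw [← hsup, hinf, finrank_map_of_injective _ hμ, finrank_map_of_injective _ hμ] at h
  have h₁ := idealHilbert_add_finrank I (m + 1)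
  have h₂ := idealHilbert_add_finrank J m
  have h₃ := idealHilbert_add_finrank K (m + 1)
  omega

theorem idealHilbert_eq_zero_of_forall_X_mem (hI : ∀ i, (X i : MvPolynomial σ k) ∈ I)
    {m : ℕ} (hm : m ≠ 0) : idealHilbert I m = 0 := by
  have : (homogeneousSubmodule σ k m).map (Ideal.Quotient.mkₐ k I).toLinearMap = ⊥ := by
    rw [← le_bot_iff, Submodule.map_le_iff_le_comap, Submodule.comap_bot, ker_mkₐ_toLinearMap]
    intro f hf
    change f ∈ I
    rw [f.as_sum]
    refine Ideal.sum_mem _ fun d hd => ?_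
    have hd' : d.degree = m := by
      exact ((hf : f.IsHomogeneous m).degree_eq_sum_deg_support hd).symm
    obtain ⟨i, hi⟩ : ∃ i, d i ≠ 0 := by
      by_contra! h
      exact hm (by rw [← hd', show d = 0 from Finsupp.ext h, map_zero])
    exact I.mem_of_dvd ((X_dvd_monomial).2 (Or.inr hi)) (hI i)
  rw [idealHilbert, this, finrank_bot]

/-- The **Hilbert–Serre theorem** for a homogeneous ideal of a polynomial ring. -/
theorem eventuallyPolynomial_idealHilbert [Finite σ] (hI : IsHomogeneousIdeal I) :
    EventuallyPolynomial fun m => (idealHilbert I m : ℚ) := by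
  classical
  have := Fintype.ofFinite σ
  -- Induction on a set of variables outside of which all variables lie in `I`, and inside it
  -- Noetherian induction on `I`.
  suffices H : ∀ (s : Finset σ) (I : Ideal (MvPolynomial σ k)), IsHomogeneousIdeal I →
      (∀ i ∉ s, (X i : MvPolynomial σ k) ∈ I) →
      EventuallyPolynomial fun m => (idealHilbert I m : ℚ) from
    H Finset.univ I hI fun i hi => absurd (Finset.mem_univ i) hi
  intro s
  induction s using Finset.induction_on with
  | empty =>
    intro I _ hX
    refine ⟨0, Filter.eventually_atTop.2 ⟨1, fun m hm => ?_⟩⟩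
    simp [idealHilbert_eq_zero_of_forall_X_mem (fun i => hX i (by simp))
      (show m ≠ 0 by omega)]
  | insert i s _ ih =>
    intro I
    induction I using IsNoetherian.induction with
    | _ I ihI =>
    intro hI hX
    have hle : I ≤ I.colon {(X i : MvPolynomial σ k)} := fun f hf =>
      Submodule.mem_colon_singleton.2 (Ideal.mul_mem_right _ _ hf)
    have hsup := ih _ (hI.sup_span_X i) fun j hj => by
      by_cases h : j = i
      · exact h ▸ Ideal.mem_sup_right (Ideal.mem_span_singleton_self _)
      · exact Ideal.mem_sup_left (hX j (by simp [h, hj]))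
    -- If `I : x = I`, the sequence gives the difference of the Hilbert function, which is then
    -- summed. Otherwise `I : x` is strictly larger and the Noetherian induction applies.
    rcases hle.eq_or_lt with heq | hlt
    · obtain ⟨P, hP⟩ := hsup.comp_succ
      obtain ⟨Q, hQ, -⟩ := exists_polynomial_of_sub_eq (f := fun m => (idealHilbert I m : ℚ))
        (P := P) <| by
          filter_upwards [hP] with m hm
          rw [← hm, idealHilbert_succ hI i m, ← heq]
          push_cast
          ring
      exact ⟨Q, hQ⟩
    · have hcolon := ihI _ hlt (hI.colon_X i) fun j hj => hle (hX j hj)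
      apply eventuallyPolynomial_of_succ
      simpa only [idealHilbert_succ hI i, Nat.cast_add] using hcolon.add hsup.comp_succ

end HilbertFunction

/-! ### Krull dimension of integral extensions. -/

/-- Incomparability makes contraction of primes strictly monotone, which gives `≤`. Lying over and
going up lift chains, which gives `≥`; the lift is built from below, so the induction records the
prime under its last member. -/
theorem ringKrullDim_eq_of_isIntegral {A R : Type*} [CommRing A] [CommRing R] [Algebra A R]
    [Algebra.IsIntegral A R] (h : Function.Injective (algebraMap A R)) :
    ringKrullDim R = ringKrullDim A := by
  apply le_antisymm
  · refine Order.krullDim_le_of_strictMono (PrimeSpectrum.comap (algebraMap A R)) fun P Q hPQ => ?_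
    exact Ideal.IsIntegral.comap_lt_comap (R := A) (show P.asIdeal < Q.asIdeal from hPQ)
  · suffices H : ∀ p : LTSeries (PrimeSpectrum A), ∃ q : LTSeries (PrimeSpectrum R),
        q.length = p.length ∧ PrimeSpectrum.comap (algebraMap A R) q.last = p.last by
      refine iSup_le fun p => ?_
      obtain ⟨q, hq, -⟩ := H p
      rw [← hq]
      exact le_iSup (fun q : LTSeries (PrimeSpectrum R) => (q.length : WithBot ℕ∞)) q
    intro p
    induction p using RelSeries.inductionOn' with
    | singleton P =>
      obtain ⟨Q, -, hQ, hQP⟩ := Ideal.exists_ideal_over_prime_of_isIntegral P.asIdeal (⊥ : Ideal R)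
        (by
          rw [← RingHom.ker_eq_comap_bot, (RingHom.injective_iff_ker_eq_bot _).1 h]
          exact bot_le)
      exact ⟨RelSeries.singleton _ ⟨Q, hQ⟩, rfl, PrimeSpectrum.ext hQP⟩
    | snoc p P hP ih =>
      obtain ⟨q, hq, hqp⟩ := ih
      have hlt : p.last < P := hP
      obtain ⟨Q, hqQ, hQ, hQP⟩ := Ideal.exists_ideal_over_prime_of_isIntegral_of_isPrime P.asIdeal
        q.last.asIdeal (by
          rw [← PrimeSpectrum.comap_asIdeal, hqp]
          exact hlt.le)
      have hlast : q.last < ⟨Q, hQ⟩ := by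
        refine lt_of_le_of_ne hqQ fun heq => hlt.ne ?_
        rw [← hqp, heq]
        exact PrimeSpectrum.ext hQP
      refine ⟨q.snoc ⟨Q, hQ⟩ hlast, by simp [hq], ?_⟩
      rw [RelSeries.last_snoc, RelSeries.last_snoc]
      exact PrimeSpectrum.ext hQP

theorem ringKrullDim_eq_of_ringHom_finite {A R : Type*} [CommRing A] [CommRing R] {f : A →+* R}
    (hf : Function.Injective f) (hfin : f.Finite) : ringKrullDim R = ringKrullDim A := by
  let : Algebra A R := f.toAlgebra
  have : Module.Finite A R := hfin
  exact ringKrullDim_eq_of_isIntegral hf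

/-! ### Growth of algebras compared with polynomial rings. -/

section Growth

variable {σ τ k R : Type*} [Field k] [CommRing R] [Algebra k R]

/-- Bounding each exponent separately makes the monomials a box, so that the count is an exact
power. -/
theorem finrank_restrictDegree [Finite τ] (m : ℕ) :
    Module.finrank k (restrictDegree τ k m) = (m + 1) ^ Nat.card τ := by
  have := Fintype.ofFinite τ
  rw [restrictDegree, Module.finrank_eq_nat_card_basis (basisRestrictSupport k _)]
  let e : {d : τ →₀ ℕ | ∀ i, d i ≤ m} ≃ (τ → Fin (m + 1)) :=
    { toFun := fun d i => ⟨d.1 i, Nat.lt_succ_of_le (d.2 i)⟩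
      invFun := fun a => ⟨Finsupp.equivFunOnFinite.symm fun i => (a i : ℕ),
        fun i => Nat.le_of_lt_succ (a i).2⟩
      left_inv := fun d => by ext i; rfl
      right_inv := fun a => by ext i; rfl }
  rw [Nat.card_congr e, Nat.card_fun]
  simp

theorem finrank_restrictTotalDegree_le [Finite τ] (m : ℕ) :
    Module.finrank k (restrictTotalDegree τ k m) ≤ (m + 1) ^ Nat.card τ := by
  rw [← finrank_restrictDegree (k := k) (τ := τ)]
  exact Submodule.finrank_mono (restrictTotalDegree_le_restrictDegree τ k m)

theorem exists_totalDegree_le {ι : Type*} [Finite ι] (f : ι → MvPolynomial σ k) :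
    ∃ D, ∀ i, (f i).totalDegree ≤ D := by
  have := Fintype.ofFinite ι
  exact ⟨Finset.univ.sup fun i => (f i).totalDegree,
    fun i => Finset.le_sup (f := fun i => (f i).totalDegree) (Finset.mem_univ i)⟩

/-- If the polynomial ring on `τ` embeds into a quotient of the polynomial ring on `σ`, then the
latter grows at least as fast. -/
theorem exists_pow_le_finrank_map [Finite σ] [Finite τ] {π : MvPolynomial σ k →ₐ[k] R}
    (hπ : Function.Surjective π) {g : MvPolynomial τ k →ₐ[k] R} (hg : Function.Injective g) :
    ∃ D, 0 < D ∧ ∀ m, (m + 1) ^ Nat.card τ ≤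
      Module.finrank k ((restrictTotalDegree σ k (D * m)).map π.toLinearMap) := by
  have := Fintype.ofFinite τ
  choose q hq using fun i => hπ (g (X i))
  obtain ⟨D, hD⟩ := exists_totalDegree_le q
  have hgq : ∀ p, g p = π (aeval q p) := by
    intro p
    have : g = π.comp (aeval q) := by
      ext i
      simp [hq]
    rw [this]
    rfl
  -- A monomial with exponents at most `m` becomes, after substituting the `q i`, a polynomial of
  -- total degree at most `Fintype.card τ * (m * D)`. The `+ 1` only ensures positivity.
  refine ⟨Fintype.card τ * D + 1, Nat.succ_pos _, fun m => ?_⟩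
  rw [← finrank_restrictDegree (k := k) (τ := τ),
    ← finrank_map_of_injective g.toLinearMap hg (restrictDegree τ k m)]
  refine Submodule.finrank_mono ?_
  rintro _ ⟨p, hp, rfl⟩
  refine ⟨aeval q p, ?_, (hgq p).symm⟩
  rw [SetLike.mem_coe, p.as_sum, map_sum]
  refine sum_mem fun d hd => ?_
  rw [mem_restrictTotalDegree, aeval_monomial, algebraMap_eq]
  refine (totalDegree_mul _ _).trans ?_
  rw [totalDegree_C, zero_add, Finsupp.prod_fintype _ _ fun i => pow_zero _]
  refine (totalDegree_finsetProd _ _).trans ?_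
  refine (Finset.sum_le_sum (g := fun _ => m * D) fun i _ => ?_).trans (by
    rw [Finset.sum_const, Finset.card_univ, smul_eq_mul, mul_left_comm, mul_comm]
    exact Nat.mul_le_mul_right _ (Nat.le_succ _))
  exact (totalDegree_pow _ _).trans
    (Nat.mul_le_mul ((mem_restrictDegree τ p m).1 hp d hd i) (hD i))

/-- If an algebra is finite over the polynomial ring on `τ`, then it grows at most as fast. -/
theorem exists_finrank_map_le [Finite σ] [Finite τ] (π : MvPolynomial σ k →ₐ[k] R)
    {g : MvPolynomial τ k →ₐ[k] R} (hg : g.Finite) :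
    ∃ t D, ∀ m, Module.finrank k ((restrictTotalDegree σ k m).map π.toLinearMap) ≤
      t * (D * (m + 1) + 1) ^ Nat.card τ := by
  let : Algebra (MvPolynomial τ k) R := g.toRingHom.toAlgebra
  have : Module.Finite (MvPolynomial τ k) R := hg
  obtain ⟨t, f, hf⟩ := Module.Finite.exists_fin' (MvPolynomial τ k) R
  have hsmul : ∀ (a : MvPolynomial τ k) (x : R), a • x = g a * x := fun a x => by
    rw [Algebra.smul_def]
    rfl
  -- The `c` are matrices, over the polynomial ring on `τ`, of multiplication by the variables on
  -- the module generators.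
  choose c hc using fun i : σ × Fin t => hf (π (X i.1) * f (Pi.single i.2 1))
  obtain ⟨u, hu⟩ := hf 1
  obtain ⟨D₁, hD₁⟩ := exists_totalDegree_le fun i : (σ × Fin t) × Fin t => c i.1 i.2
  obtain ⟨D₂, hD₂⟩ := exists_totalDegree_le u
  let D := D₁ + D₂
  have hdecomp : ∀ a : Fin t → MvPolynomial τ k, f a = ∑ l, a l • f (Pi.single l 1) := by
    intro a
    conv_lhs => rw [← Finset.univ_sum_single a, map_sum]
    refine Finset.sum_congr rfl fun l _ => ?_
    rw [← map_smul, ← Pi.single_smul, smul_eq_mul, mul_one]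
  -- The range of `Ψ m` consists of the combinations of generators with coefficients of degree at
  -- most `D * (m + 1)`. Multiplication by a variable costs at most `D₁ ≤ D`, and `m + 1` instead of
  -- `m` leaves room for the coordinates `u` of `1`.
  let Ψ (m : ℕ) : (Fin t → restrictTotalDegree τ k (D * (m + 1))) →ₗ[k] R :=
    (∑ l, (LinearMap.mulRight k (f (Pi.single l 1))) ∘ₗ g.toLinearMap ∘ₗ
      (restrictTotalDegree τ k (D * (m + 1))).subtype ∘ₗ LinearMap.proj l)
  have hΨ : ∀ m x, Ψ m x = f fun l => (x l : MvPolynomial τ k) := by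
    intro m x
    rw [hdecomp]
    simp [Ψ, hsmul]
  have hmem : ∀ m (a : Fin t → MvPolynomial τ k), (∀ l, (a l).totalDegree ≤ D * (m + 1)) →
      f a ∈ (Ψ m).range := fun m a ha =>
    ⟨fun l => ⟨a l, (mem_restrictTotalDegree _ _ _).2 (ha l)⟩, hΨ _ _⟩
  have hstep : ∀ m i x, x ∈ (Ψ m).range → π (X i) * x ∈ (Ψ (m + 1)).range := by
    rintro m i _ ⟨x, rfl⟩
    have : π (X i) * Ψ m x = f (∑ l, (x l : MvPolynomial τ k) • c (i, l)) := by
      rw [hΨ, hdecomp, Finset.mul_sum, map_sum]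
      refine Finset.sum_congr rfl fun l _ => ?_
      rw [map_smul, hc, mul_smul_comm]
    rw [this]
    refine hmem _ _ fun l => ?_
    rw [Finset.sum_apply]
    refine totalDegree_finsetSum_le fun l' _ => ?_
    refine (totalDegree_mul _ _).trans ?_
    have h₁ := (mem_restrictTotalDegree _ _ _).1 (x l').2
    have h₂ : _ ≤ D₁ := hD₁ ((i, l'), l)
    calc _ ≤ D * (m + 1) + D₁ := add_le_add h₁ h₂
      _ ≤ D * (m + 1) + D := by simp [D]
      _ = D * (m + 1 + 1) := by ring
  have hconst : ∀ (m : ℕ) (a : k), π (monomial 0 a) ∈ (Ψ m).range := by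
    intro m a
    have h₁ : (1 : R) ∈ (Ψ m).range := by
      rw [← hu]
      refine hmem _ _ fun l => (hD₂ l).trans ?_
      calc D₂ ≤ D := Nat.le_add_left _ _
        _ ≤ D * (m + 1) := Nat.le_mul_of_pos_right _ m.succ_pos
    have h₂ : π (monomial 0 a) = a • (1 : R) := by
      rw [← Algebra.algebraMap_eq_smul_one, ← AlgHom.commutes π a]
      rfl
    rw [h₂]
    exact Submodule.smul_mem _ _ h₁
  have hmono : ∀ (m : ℕ) (d : σ →₀ ℕ) (a : k), d.degree ≤ m →
      π (monomial d a) ∈ (Ψ m).range := by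
    intro m
    induction m with
    | zero =>
      intro d a hd
      obtain rfl := (Finsupp.degree_eq_zero_iff d).1 (Nat.le_zero.1 hd)
      exact hconst 0 a
    | succ m ih =>
      intro d a hd
      rcases eq_or_ne d 0 with rfl | hd₀
      · exact hconst _ a
      obtain ⟨i, hi⟩ := Finsupp.ne_iff.1 hd₀
      have hle : Finsupp.single i 1 ≤ d := by
        rw [Finsupp.single_le_iff]
        exact Nat.one_le_iff_ne_zero.2 hi
      rw [← add_tsub_cancel_of_le hle] at hd ⊢
      rw [map_add, Finsupp.degree_single] at hd
      rw [show monomial (Finsupp.single i 1 + (d - Finsupp.single i 1)) a =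
        X i * monomial (d - Finsupp.single i 1) a by rw [X, monomial_mul, one_mul], map_mul]
      exact hstep m i _ (ih _ _ (by omega))
  refine ⟨t, D, fun m => ?_⟩
  have hle : (restrictTotalDegree σ k m).map π.toLinearMap ≤ (Ψ m).range := by
    rintro _ ⟨p, hp, rfl⟩
    rw [AlgHom.toLinearMap_apply, p.as_sum, map_sum]
    refine sum_mem fun d hd => hmono m d _ ?_
    exact (le_totalDegree hd).trans ((mem_restrictTotalDegree _ _ _).1 hp)
  calc _ ≤ Module.finrank k (Ψ m).range := Submodule.finrank_mono hle
    _ ≤ Module.finrank k (Fin t → restrictTotalDegree τ k (D * (m + 1))) :=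
      LinearMap.finrank_range_le _
    _ = t * Module.finrank k (restrictTotalDegree τ k (D * (m + 1))) := by
      simp [Module.finrank_pi_fintype]
    _ ≤ _ := Nat.mul_le_mul_left _ (finrank_restrictTotalDegree_le _)

end Growth

/-- The dimension of the space of polynomials of degree at most `m` modulo a homogeneous ideal is
the sum of the values of the Hilbert function up to `m`. -/
theorem finrank_map_restrictTotalDegree_succ {σ k : Type*} [Finite σ] [Field k]
    {I : Ideal (MvPolynomial σ k)} (hI : IsHomogeneousIdeal I) (m : ℕ) :
    Module.finrank k ((restrictTotalDegree σ k (m + 1)).map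
      (Ideal.Quotient.mkₐ k I).toLinearMap) =
    Module.finrank k ((restrictTotalDegree σ k m).map (Ideal.Quotient.mkₐ k I).toLinearMap) +
      idealHilbert I (m + 1) := by
  set π := (Ideal.Quotient.mkₐ k I).toLinearMap with hπ
  have hsup : restrictTotalDegree σ k (m + 1) =
      restrictTotalDegree σ k m ⊔ homogeneousSubmodule σ k (m + 1) := by
    apply le_antisymm
    · intro p hp
      rw [mem_restrictTotalDegree] at hp
      rw [← sum_homogeneousComponent p]
      refine sum_mem fun i hi => ?_
      rcases (show i ≤ m + 1 by have := Finset.mem_range.1 hi; omega).lt_or_eq with h | rfl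
      · refine Submodule.mem_sup_left ((mem_restrictTotalDegree _ _ _).2 ?_)
        exact (homogeneousComponent_isHomogeneous i p).totalDegree_le.trans (by omega)
      · exact Submodule.mem_sup_right (homogeneousComponent_mem _ _)
    · refine sup_le (fun p hp => ?_) fun p hp => ?_
      · rw [mem_restrictTotalDegree] at hp ⊢
        omega
      · exact (mem_restrictTotalDegree _ _ _).2 (IsHomogeneous.totalDegree_le hp)
  -- If a form of degree `m + 1` is congruent to a polynomial of lower degree, the component of
  -- degree `m + 1` of their difference is the form itself, so it lies in `I`.
  have hinf : (restrictTotalDegree σ k m).map π ⊓ (homogeneousSubmodule σ k (m + 1)).map π = ⊥ := by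
    rw [eq_bot_iff]
    rintro _ ⟨⟨p, hp, rfl⟩, q, hq, hqp⟩
    have h₁ : q - p ∈ I := Ideal.Quotient.eq.1 hqp
    have h₂ := hI _ h₁ (m + 1)
    rw [map_sub, homogeneousComponent_eq_self hq, homogeneousComponent_eq_zero _ _
      (Nat.lt_succ_of_le ((mem_restrictTotalDegree _ _ _).1 hp)), sub_zero] at h₂
    rw [Submodule.mem_bot, ← hqp]
    exact Ideal.Quotient.eq_zero_iff_mem.2 h₂
  have h := Submodule.finrank_sup_add_finrank_inf_eq ((restrictTotalDegree σ k m).map π)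
    ((homogeneousSubmodule σ k (m + 1)).map π)
  rw [hinf, finrank_bot, add_zero, ← Submodule.map_sup, ← hsup] at h
  exact h

/-! ### The degree of the Hilbert polynomial. -/

section Degree

theorem leadingCoeff_nonneg_of_eventually_nonneg {P : Polynomial ℚ}
    (h : ∀ᶠ m : ℕ in Filter.atTop, 0 ≤ P.eval (m : ℚ)) : 0 ≤ P.leadingCoeff := by
  by_contra! hneg
  rcases Nat.eq_zero_or_pos P.natDegree with h₀ | h₀
  · rw [Polynomial.eq_C_of_natDegree_eq_zero h₀] at h hneg
    obtain ⟨m, hm⟩ := h.exists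
    simp at hm hneg
    exact hneg.not_ge hm
  · have ht := (P.tendsto_atBot_of_leadingCoeff_nonpos
      (Polynomial.natDegree_pos_iff_degree_pos.1 h₀) hneg.le).comp
      (tendsto_natCast_atTop_atTop (R := ℚ))
    obtain ⟨m, hm, hm'⟩ := (h.and (ht.eventually (Filter.eventually_lt_atBot 0))).exists
    exact absurd hm (not_le.2 hm')

theorem natDegree_le_of_eventually_le {P Q : Polynomial ℚ}
    (hP : 0 < P.leadingCoeff)
    (h : ∀ᶠ m : ℕ in Filter.atTop, P.eval (m : ℚ) ≤ Q.eval (m : ℚ)) :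
    P.natDegree ≤ Q.natDegree := by
  by_contra! hlt
  have h₁ : 0 ≤ (Q - P).leadingCoeff := leadingCoeff_nonneg_of_eventually_nonneg <| by
    filter_upwards [h] with m hm
    simpa using hm
  rw [Polynomial.leadingCoeff_sub_of_degree_lt' (Polynomial.degree_lt_degree hlt)] at h₁
  linarith

/-- The degree of a nonzero polynomial is the order of its last nonzero iterated difference, and `P`
starts one difference after `Q`. -/
theorem natDegree_eq_of_fwdDiff_eq {P Q : Polynomial ℚ} {r : ℕ} (hQ : Q.natDegree = r + 1)
    (h : ∀ x, Q.eval (x + 1) - Q.eval x = P.eval x) : P.natDegree = r := by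
  have hfun : fwdDiff 1 (fun x => Q.eval x) = fun x => P.eval x := funext fun x => h x
  have hiter : ∀ j, (fwdDiff 1)^[j + 1] (fun x => Q.eval x) =
      (fwdDiff 1)^[j] fun x => P.eval x := fun j => by
    rw [Function.iterate_succ_apply, hfun]
  have hlead : ∀ T : Polynomial ℚ, T ≠ 0 →
      (fwdDiff 1)^[T.natDegree] (fun x => T.eval x) ≠ 0 := by
    intro T hT h₀
    rw [Polynomial.fwdDiff_iter_degree_eq_factorial] at h₀
    have h₁ := congrFun h₀ 0
    simp [hT, Nat.factorial_ne_zero] at h₁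
  apply le_antisymm
  · by_contra! hlt
    refine hlead P (fun h₀ => by simp [h₀] at hlt) ?_
    rw [← hiter]
    exact Polynomial.fwdDiff_iter_eq_zero_of_degree_lt (by omega)
  · by_contra! hlt
    refine hlead Q (fun h₀ => by simp [h₀] at hQ) ?_
    rw [hQ, hiter]
    exact Polynomial.fwdDiff_iter_eq_zero_of_degree_lt hlt

/-- The degree of the Hilbert polynomial is one less than the Krull dimension. -/
theorem exists_hilbertPolynomial {σ k : Type*} [Finite σ] [Field k]
    {I : Ideal (MvPolynomial σ k)} (hI : IsHomogeneousIdeal I) {r : ℕ}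
    (hr : ringKrullDim (MvPolynomial σ k ⧸ I) = ((r + 1 : ℕ) : WithBot ℕ∞)) :
    ∃ P : Polynomial ℚ, (∀ᶠ m : ℕ in Filter.atTop, (idealHilbert I m : ℚ) = P.eval (m : ℚ)) ∧
      P.natDegree = r ∧ 0 ≤ P.leadingCoeff := by
  obtain ⟨P, hP⟩ := eventuallyPolynomial_idealHilbert hI
  refine ⟨P, hP, ?_, leadingCoeff_nonneg_of_eventually_nonneg (hP.mono fun m hm => by
    rw [← hm]; positivity)⟩
  let F (m : ℕ) : ℕ := Module.finrank k ((restrictTotalDegree σ k m).map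
    (Ideal.Quotient.mkₐ k I).toLinearMap)
  -- `F (m + 1) - F m` is the Hilbert function at `m + 1`, hence the shift of `P`.
  obtain ⟨Q, hQ, hQP⟩ := exists_polynomial_of_sub_eq (f := fun m => (F m : ℚ))
    (P := P.comp (Polynomial.X + Polynomial.C 1)) <| by
      filter_upwards [(Filter.tendsto_add_atTop_nat 1).eventually hP] with m hm
      simp only [F, finrank_map_restrictTotalDegree_succ hI]
      simp [hm]
  have : Nontrivial (MvPolynomial σ k ⧸ I) := by
    by_contra h
    rw [not_nontrivial_iff_subsingleton] at h
    rw [ringKrullDim_eq_bot_of_subsingleton] at hr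
    exact WithBot.bot_ne_coe hr
  obtain ⟨s, g, hg, hgf⟩ := exists_finite_inj_algHom_of_fg k (MvPolynomial σ k ⧸ I)
  have hs : s = r + 1 := by
    rw [ringKrullDim_eq_of_ringHom_finite (f := g.toRingHom) hg hgf,
      MvPolynomial.ringKrullDim_of_isNoetherianRing, ringKrullDim_eq_zero_of_field, zero_add,
      Nat.card_fin] at hr
    exact_mod_cast hr
  obtain ⟨D, hD, hlow⟩ := exists_pow_le_finrank_map (Ideal.Quotient.mkₐ_surjective k I) hg
  obtain ⟨t, E, hup⟩ := exists_finrank_map_le (Ideal.Quotient.mkₐ k I) hgf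
  rw [Nat.card_fin] at hlow hup
  -- Here `(m + 1) ^ s ≤ F (D * m)`, and rescaling the argument by `D > 0` keeps the degree.
  have hs₁ : s ≤ Q.natDegree := by
    have hmonic : ((Polynomial.X + Polynomial.C 1 : Polynomial ℚ) ^ s).Monic :=
      (Polynomial.monic_X_add_C 1).pow s
    have h := natDegree_le_of_eventually_le (P := (Polynomial.X + Polynomial.C 1) ^ s)
      (Q := Q.comp (Polynomial.C (D : ℚ) * Polynomial.X)) (by rw [hmonic]; exact one_pos) <| by
        have htend : Filter.Tendsto (fun m : ℕ => D * m) Filter.atTop Filter.atTop :=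
          Filter.tendsto_id.const_mul_atTop' hD
        filter_upwards [htend.eventually hQ] with m hm
        have h₁ : ((m + 1 : ℕ) : ℚ) ^ s ≤ F (D * m) := by exact_mod_cast hlow m
        rw [hm] at h₁
        simpa using h₁
    rwa [Polynomial.natDegree_pow, Polynomial.natDegree_X_add_C, mul_one,
      Polynomial.natDegree_comp, Polynomial.natDegree_C_mul_X _ (by positivity), mul_one] at h
  have hQ₀ : Q ≠ 0 := by
    rintro rfl
    simp [hs] at hs₁
  have hs₂ : Q.natDegree ≤ s := by
    have hlead : 0 ≤ Q.leadingCoeff := leadingCoeff_nonneg_of_eventually_nonneg <|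
      hQ.mono fun m hm => by rw [← hm]; positivity
    refine (natDegree_le_of_eventually_le (Q := Polynomial.C (t : ℚ) *
      (Polynomial.C (E : ℚ) * Polynomial.X + Polynomial.C (E + 1 : ℚ)) ^ s)
      (hlead.lt_of_ne (Polynomial.leadingCoeff_ne_zero.2 hQ₀).symm) ?_).trans ?_
    · filter_upwards [hQ] with m hm
      have h₁ : (F m : ℚ) ≤ ((t * (E * (m + 1) + 1) ^ s : ℕ) : ℚ) := by exact_mod_cast hup m
      rw [hm] at h₁
      refine h₁.trans_eq ?_
      simp only [Nat.cast_mul, Nat.cast_pow, Nat.cast_add, Nat.cast_one, Polynomial.eval_mul,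
        Polynomial.eval_pow, Polynomial.eval_add, Polynomial.eval_C, Polynomial.eval_X]
      ring
    · refine (Polynomial.natDegree_C_mul_le _ _).trans (Polynomial.natDegree_pow_le.trans ?_)
      exact (Nat.mul_le_mul_left s Polynomial.natDegree_linear_le).trans_eq (mul_one s)
  have h := natDegree_eq_of_fwdDiff_eq (r := r) (by omega) hQP
  rwa [Polynomial.natDegree_comp, Polynomial.natDegree_X_add_C, mul_one] at h

end Degree

/-- A complex vector space with a quaternionic structure has even dimension. -/
theorem even_finrank_of_quaternionic {V : Type*} [AddCommGroup V] [Module ℂ V]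
    [FiniteDimensional ℂ V] (J : V →ₛₗ[starRingEnd ℂ] V) (hJ : ∀ v, J (J v) = -v) :
    Even (Module.finrank ℂ V) := by
  let b := Module.finBasis ℂ V
  -- In coordinates `J` is `v ↦ A * conj v`, so `J ∘ J = -1` reads `A * conj A = -1`. Determinants
  -- then give `|det A| ^ 2 = (-1) ^ dim`, which excludes odd dimension.
  let A : Matrix (Fin (Module.finrank ℂ V)) (Fin (Module.finrank ℂ V)) ℂ :=
    Matrix.of fun i j => b.repr (J (b j)) i
  have hexp : ∀ j, J (b j) = ∑ i, A i j • b i := fun j => (b.sum_repr (J (b j))).symm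
  have hA : A * A.map (starRingEnd ℂ) = -1 := by
    ext i j
    have h : b.repr (J (J (b j))) i = (A * A.map (starRingEnd ℂ)) i j := by
      rw [hexp j, map_sum, map_sum, Finsupp.finsetSum_apply, Matrix.mul_apply]
      refine Finset.sum_congr rfl fun l _ => ?_
      rw [map_smulₛₗ, map_smul, Finsupp.smul_apply, smul_eq_mul, mul_comm]
      rfl
    rw [← h, hJ, map_neg, Finsupp.neg_apply, b.repr_self, Matrix.neg_apply, Matrix.one_apply,
      Finsupp.single_apply]
    simp only [eq_comm]
  have hdet := congrArg Matrix.det hA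
  rw [Matrix.det_mul, Matrix.det_neg, Matrix.det_one, mul_one, Fintype.card_fin,
    show A.map (starRingEnd ℂ) = (starRingEnd ℂ).mapMatrix A from rfl, ← RingHom.map_det,
    Complex.mul_conj] at hdet
  by_contra hodd
  rw [Nat.not_even_iff_odd] at hodd
  rw [hodd.neg_one_pow] at hdet
  have h : Complex.normSq A.det = -1 := by exact_mod_cast hdet
  linarith [Complex.normSq_nonneg A.det]

theorem _root_.MvPolynomial.IsHomogeneous.eval_smul {σ R : Type*} [CommSemiring R]
    {f : MvPolynomial σ R} {m : ℕ} (hf : f.IsHomogeneous m) (t : R) (v : σ → R) :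
    eval (t • v) f = t ^ m * eval v f := by
  rw [eval_eq, eval_eq, Finset.mul_sum]
  refine Finset.sum_congr rfl fun d hd => ?_
  rw [hf.degree_eq_sum_deg_support hd, ← Finset.prod_pow_eq_pow_sum, mul_left_comm,
    ← Finset.prod_mul_distrib]
  simp only [Pi.smul_apply, smul_eq_mul, mul_pow]

/-! ### The action of `j` on polynomials and on the coordinate ring. -/

variable {n : ℕ}

/-- The linear substitution `(z, w) ↦ (-w, z)`. -/
noncomputable def quatSubst (n : ℕ) :
    MvPolynomial (Fin n ⊕ Fin n) ℂ →ₐ[ℂ] MvPolynomial (Fin n ⊕ Fin n) ℂ :=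
  aeval (Sum.elim (fun l => -X (Sum.inr l)) fun l => X (Sum.inl l))

/-- The antilinear ring endomorphism `f ↦ conj (f (j ·))` of the polynomial ring. -/
noncomputable def polyJ (n : ℕ) :
    MvPolynomial (Fin n ⊕ Fin n) ℂ →+* MvPolynomial (Fin n ⊕ Fin n) ℂ :=
  (quatSubst n).toRingHom.comp (MvPolynomial.map (starRingEnd ℂ))

theorem polyJ_C (a : ℂ) : polyJ n (C a) = C (starRingEnd ℂ a) := by
  simp [polyJ, quatSubst]

theorem polyJ_smul (a : ℂ) (f : MvPolynomial (Fin n ⊕ Fin n) ℂ) :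
    polyJ n (a • f) = starRingEnd ℂ a • polyJ n f := by
  rw [smul_eq_C_mul, map_mul, polyJ_C, ← smul_eq_C_mul]

theorem eval_polyJ (f : MvPolynomial (Fin n ⊕ Fin n) ℂ) (v : HSpace n) :
    eval v (polyJ n f) = starRingEnd ℂ (eval (jLin n v) f) := by
  suffices (eval v).comp (polyJ n) = (starRingEnd ℂ).comp (eval (jLin n v)) from
    RingHom.congr_fun this f
  refine MvPolynomial.ringHom_ext (fun a => ?_) fun i => ?_
  · simp [polyJ_C]
  · rcases i with l | l <;> simp [polyJ, quatSubst, jLin]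

theorem isHomogeneous_polyJ {f : MvPolynomial (Fin n ⊕ Fin n) ℂ} {m : ℕ}
    (hf : f.IsHomogeneous m) : (polyJ n f).IsHomogeneous m := by
  have h := (hf.map (starRingEnd ℂ)).aeval
    (Sum.elim (fun l => -X (Sum.inr l)) fun l => X (Sum.inl l) :
      Fin n ⊕ Fin n → MvPolynomial (Fin n ⊕ Fin n) ℂ) (n := 1) (by
        rintro (l | l)
        · exact (isHomogeneous_X _ _).neg
        · exact isHomogeneous_X _ _)
  rwa [one_mul] at h

/-- Applying `polyJ` twice evaluates `f` at `j (j v) = -v`, and a form of odd degree is an odd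
function. -/
theorem polyJ_polyJ {f : MvPolynomial (Fin n ⊕ Fin n) ℂ} {m : ℕ} (hf : f.IsHomogeneous m)
    (hm : Odd m) : polyJ n (polyJ n f) = -f := by
  apply MvPolynomial.funext
  intro v
  rw [eval_polyJ, eval_polyJ, jLin_jLin, map_neg, Complex.conj_conj, ← neg_one_smul ℂ v,
    hf.eval_smul, hm.neg_one_pow, neg_one_mul]

variable {Y : Set (ℙ ℂ (HSpace n))}

theorem smul_mem_cone {v : HSpace n} (hv : v ∈ cone Y) {t : ℂ} (ht : t ≠ 0) :
    t • v ∈ cone Y := by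
  obtain ⟨hv₀, hv⟩ := hv
  refine ⟨smul_ne_zero ht hv₀, ?_⟩
  rwa [(Projectivization.mk_eq_mk_iff' ℂ _ _ (smul_ne_zero ht hv₀) hv₀).2 ⟨t, rfl⟩]

theorem jLin_mem_cone (h : jProj n '' Y = Y) {v : HSpace n} (hv : v ∈ cone Y) :
    jLin n v ∈ cone Y := by
  obtain ⟨hv₀, hv⟩ := hv
  have h₀ : jLin n v ≠ 0 := by
    rw [← map_zero (jLin n)]
    exact (jLin_injective n).ne hv₀
  refine ⟨h₀, ?_⟩
  rw [← h]
  exact ⟨_, hv, Projectivization.map_mk _ _ _ _⟩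

theorem polyJ_mem_idealOf (h : jProj n '' Y = Y) {f : MvPolynomial (Fin n ⊕ Fin n) ℂ}
    (hf : f ∈ idealOf Y) : polyJ n f ∈ idealOf Y := by
  rw [idealOf, mem_vanishingIdeal_iff] at hf ⊢
  intro v hv
  have := hf _ (jLin_mem_cone h hv)
  rw [aeval_eq_eval] at this ⊢
  rw [eval_polyJ, this, map_zero]

/-- For `v` in the cone, `t ↦ f (t v)` is a polynomial in `t` with coefficients `f_i (v)`. It
vanishes at every `t ≠ 0`, so all its coefficients are zero. -/
theorem isHomogeneousIdeal_idealOf : IsHomogeneousIdeal (idealOf Y) := by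
  intro f hf m
  rw [idealOf, mem_vanishingIdeal_iff] at hf ⊢
  intro v hv
  rw [aeval_eq_eval]
  let p : Polynomial ℂ := ∑ i ∈ Finset.range (f.totalDegree + 1),
    Polynomial.monomial i (eval v (homogeneousComponent i f))
  have hp : p = 0 := by
    refine Polynomial.eq_zero_of_infinite_isRoot p
      ((Set.finite_singleton (0 : ℂ)).infinite_compl.mono fun t ht => ?_)
    have h := hf _ (smul_mem_cone hv ht)
    rw [aeval_eq_eval, ← sum_homogeneousComponent f, map_sum] at h
    rw [Set.mem_ofPred_eq, Polynomial.IsRoot, Polynomial.eval_finsetSum, ← h]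
    refine Finset.sum_congr rfl fun i _ => ?_
    rw [Polynomial.eval_monomial, (homogeneousComponent_isHomogeneous i f).eval_smul, mul_comm]
  rcases lt_or_ge f.totalDegree m with hm | hm
  · rw [homogeneousComponent_eq_zero _ _ hm, map_zero]
  · have h := congrArg (fun q => Polynomial.coeff q m) hp
    simpa [p, Polynomial.finsetSum_coeff, Polynomial.coeff_monomial,
      Nat.lt_succ_iff.2 hm] using h

/-- The antilinear ring endomorphism of the homogeneous coordinate ring induced by `j`. -/
noncomputable def coordJ (h : jProj n '' Y = Y) : CoordRing Y →+* CoordRing Y :=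
  Ideal.quotientMap (idealOf Y) (polyJ n) fun _ hf => polyJ_mem_idealOf h hf

/-- The antilinear operator induced by `j` on a graded piece of the homogeneous coordinate
ring. -/
noncomputable def gradedJ (h : jProj n '' Y = Y) (m : ℕ) :
    gradedPiece Y m →ₛₗ[starRingEnd ℂ] gradedPiece Y m where
  toFun x := ⟨coordJ h x, by
    obtain ⟨_, f, hf, rfl⟩ := x
    exact ⟨polyJ n f, isHomogeneous_polyJ hf, rfl⟩⟩
  map_add' x y := Subtype.ext (map_add _ _ _)
  map_smul' a x := by
    obtain ⟨_, f, hf, rfl⟩ := x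
    exact Subtype.ext (congrArg (Ideal.Quotient.mkₐ ℂ (idealOf Y)) (polyJ_smul a f))

theorem gradedJ_gradedJ (h : jProj n '' Y = Y) {m : ℕ} (hm : Odd m) (x : gradedPiece Y m) :
    gradedJ h m (gradedJ h m x) = -x := by
  obtain ⟨_, f, hf, rfl⟩ := x
  exact Subtype.ext (congrArg (Ideal.Quotient.mkₐ ℂ (idealOf Y)) (polyJ_polyJ hf hm))

theorem even_hilbertFunction (h : jProj n '' Y = Y) {m : ℕ} (hm : Odd m) :
    Even (hilbertFunction Y m) := by
  have : FiniteDimensional ℂ (gradedPiece Y m) := by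
    rw [gradedPiece]
    infer_instance
  exact even_finrank_of_quaternionic (gradedJ h m) (gradedJ_gradedJ h hm)

/-! ### Parity of the leading coefficient, and the theorem. -/

theorem even_choose_of_even_of_odd {r l : ℕ} (hr : Even r) (hl : Odd l) : Even (r.choose l) := by
  obtain ⟨l, rfl⟩ : ∃ i, l = i + 1 := ⟨l - 1, by have := hl.pos; omega⟩
  rcases r with _ | r
  · simp
  -- The identity `l * C(r, l) = r * C(r - 1, l - 1)` has an even right side, and `l` is odd.
  · have h : Even (Nat.choose (r + 1) (l + 1) * (l + 1)) := by
      rw [← Nat.add_one_mul_choose_eq]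
      exact hr.mul_right _
    exact (Nat.even_mul.1 h).resolve_right (Nat.not_even_iff_odd.2 hl)

/-- If an integer-valued polynomial of even degree has even values at large odd numbers, then its
normalized leading coefficient is an even integer. -/
theorem exists_even_eq_factorial_mul_leadingCoeff {P : Polynomial ℚ} {f : ℕ → ℕ}
    (hP : ∀ᶠ m : ℕ in Filter.atTop, (f m : ℚ) = P.eval (m : ℚ)) (hdeg : Even P.natDegree)
    (hf : ∀ m, Odd m → Even (f m)) :
    ∃ d : ℤ, (d : ℚ) = (P.natDegree)! * P.leadingCoeff ∧ Even d := by
  obtain ⟨N, hN⟩ := Filter.eventually_atTop.1 hP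
  let r := P.natDegree
  -- This is the `r`-th forward difference at `2 * N + 1`, an odd base point beyond which `f` agrees
  -- with `P`.
  refine ⟨∑ l ∈ Finset.range (r + 1), ((-1) ^ (r - l) * (r.choose l : ℤ)) * f (2 * N + 1 + l),
    ?_, Finset.even_sum _ fun l _ => ?_⟩
  · have h := congrFun (Polynomial.fwdDiff_iter_degree_eq_factorial P) ((2 * N + 1 : ℕ) : ℚ)
    rw [fwdDiff_iter_eq_sum_shift] at h
    rw [show (P.leadingCoeff • (P.natDegree ! : ℚ → ℚ)) ((2 * N + 1 : ℕ) : ℚ) =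
      P.leadingCoeff * (P.natDegree ! : ℚ) from rfl] at h
    rw [mul_comm (P.natDegree ! : ℚ), ← h]
    push_cast
    refine Finset.sum_congr rfl fun l _ => ?_
    rw [hN _ (by omega)]
    simp [r]
  · rcases Nat.even_or_odd l with hl | hl
    · refine Even.mul_left ?_ _
      exact_mod_cast hf _ (Even.add_odd (even_two_mul N) odd_one |>.add_even hl)
    · refine Even.mul_right (Even.mul_left ?_ _) _
      exact_mod_cast even_choose_of_even_of_odd hdeg hl

end QuaternionicVariety

theorem proposition8p4 (n : ℕ) (X : Set (ℙ ℂ (QuaternionicVariety.HSpace n)))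
    (hX : QuaternionicVariety.IsQuaternionicVariety X)
    (c : ℕ) (hc : QuaternionicVariety.HasCodim X c) (hodd : Odd c) :
    ∃ d : ℕ, QuaternionicVariety.HasDegree X d ∧ Even d := by
  obtain ⟨r, hr, hrc⟩ := hc
  obtain ⟨P, hP, hdeg, hlead⟩ := QuaternionicVariety.exists_hilbertPolynomial
    QuaternionicVariety.isHomogeneousIdeal_idealOf hr
  have hre : Even P.natDegree := by
    rw [hdeg]
    obtain ⟨b, rfl⟩ := hodd
    -- From `r + c + 1 = 2 * n` and `c = 2 * b + 1` follows `r = 2 * (n - 1 - b)`.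
    exact ⟨n - 1 - b, by omega⟩
  obtain ⟨d, hd, hde⟩ := QuaternionicVariety.exists_even_eq_factorial_mul_leadingCoeff
    (f := QuaternionicVariety.hilbertFunction X) hP hre
    fun m hm => QuaternionicVariety.even_hilbertFunction hX.invariant hm
  have hd₀ : 0 ≤ d := by
    have : (0 : ℚ) ≤ d := by
      rw [hd]
      positivity
    exact_mod_cast this
  lift d to ℕ using hd₀
  exact ⟨d, ⟨P, hP, by exact_mod_cast hd⟩, by exact_mod_cast hde⟩
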